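/- Let $\mathcal X\subseteq\mathbb R^n$ and $\mathcal V\subseteq\mathbb R^m$, and let $G$ assign to each $(x,v)\in\mathcal X\times\mathcal V$ a set $G(x,v)\subseteq\mathcal X$. Assume: 1. for each $v\in\mathcal V$ the map $x\mapsto G(x,v)$ is upper semicontinuous on $\mathcal X$: for all $x\in\mathcal X$ and $\varepsilon>0$ there is a neighbourhood $U$ of $x$ such that $G(y,v)\subseteq G(x,v)+\varepsilon\mathbb B$ for all $y\in U\cap\mathcal X$, where $\mathbb B$ is the open unit ball; 2. $G$ is locally bounded on $\mathcal X\times\mathcal V$: each point of $\mathcal X\times\mathcal V$ has a neighbourhood on whose intersection with $\mathcal X\times\mathcal V$ the values of $G$ lie in a common ball; 3. each $G(x,v)$ is nonempty, closed and convex; 4. the set-valued map $v\mapsto\operatorname{graph}G(\cdot,v)=\{(x,y)\in\mathcal X\times\mathcal X: y\in G(x,v)\}$ is measurable, i.e. $\{v\in\mathcal V:\operatorname{graph}G(\cdot,v)\cap O\neq\emptyset\}$ is a Borel subset of $\mathcal V$ for every open $O\subseteq\mathbb R^n\times\mathbb R^n$; 5. $G$ is a convex set-valued map, i.e. its graph $\{(x,v,y):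 x\in\mathcal X,\ v\in\mathcal V,\ y\in G(x,v)\}$ is convex. Let $v_0,v_1,\dots$ be i.i.d. random vectors on a probability space $(\Omega,\mathcal F,\mathbb P)$ with values in $\mathcal V$ and with common law $\mu$ having finite mean $\mathbb E[v]$. For $S\subseteq\mathcal X$ put $\lambda_0^S(x)=\mathcal I_S(x)$ (the indicator function of $S$) and $$\lambda_{k+1}^S(x,v_0,\dots,v_k)=\sup_{y\in G(x,v_0)}\lambda_k^S(y,v_1,\dots,v_k),\qquad k\ge 0,$$ so that $\lambda_k^S(x,v_0,\dots,v_{k-1})\ge 1$ if and only if, for this input sequence, an adversary choosing $x_{i+1}\in G(x_i,v_i)$ can bring the state from $x_0=x$ into $S$ at step $k$. Let $X_0,X_u\subseteq\mathcal X$, let $0\le\delta<\Delta$, and let $B:\mathcal X\to\mathbb R_{\ge0}$ be upper semicontinuous and concave with $B\le\delta$ on $X_0$ and $B\ge\Delta$ on $X_u$. Suppose that $$\sup_{x^+\in G(x,\mathbb E[v])}B(x^+)\le B(x)\qquad\text{for every }x\in\mathcal X\setminus X_u .$$ Then for every $N\in\mathbb N\cup\{\infty\}$ and every $x\in X_0$,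 $$\mathbb P\big(\exists\,k\in\mathbb N,\ 1\le k\le N:\ \lambda_k^{X_u}(x,v_0,\dots,v_{k-1})\ge1\big)\le\frac{\delta}{\Delta}.$$ (If the event on the left is not measurable, $\mathbb P$ denotes the outer probability.) -/

import Mathlib

open MeasureTheory ProbabilityTheory Topology
open scoped Pointwise

noncomputable section

/-- Upper semicontinuity of a set-valued map `F` on `D`: for every `x ∈ D` and `ε > 0` there is
a neighbourhood `U` of `x` with `F y ⊆ F x + ε 𝔹` for all `y ∈ U ∩ D`. -/
def SetValuedUSCOn {α β : Type*} [TopologicalSpace α] [NormedAddCommGroup β]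
    (F : α → Set β) (D : Set α) : Prop :=
  ∀ x ∈ D, ∀ ε : ℝ, 0 < ε → ∃ U ∈ 𝓝 x, ∀ y ∈ U ∩ D, F y ⊆ F x + Metric.ball (0 : β) ε

/-- Local boundedness of a set-valued map `F` on `D`. -/
def SetValuedLocallyBoundedOn {α β : Type*} [TopologicalSpace α] [NormedAddCommGroup β]
    (F : α → Set β) (D : Set α) : Prop :=
  ∀ x ∈ D, ∃ U ∈ 𝓝 x, ∃ b : ℝ, 0 < b ∧ ∀ y ∈ U ∩ D, ∀ z ∈ F y, ‖z‖ ≤ b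

/-- A set-valued map `F` with domain `D` is convex if its graph is convex. -/
def SetValuedConvexOn {α β : Type*} [AddCommGroup α] [Module ℝ α] [AddCommGroup β] [Module ℝ β]
    (F : α → Set β) (D : Set α) : Prop :=
  Convex ℝ {p : α × β | p.1 ∈ D ∧ p.2 ∈ F p.1}

/-- A set-valued map on a measurable space is measurable if the inverse image
`{t | S t ∩ O ≠ ∅}` of every open set `O` is measurable. -/
def SetValuedMeasurable {τ β : Type*} [MeasurableSpace τ] [TopologicalSpace β]
    (S : τ → Set β) : Prop :=
  ∀ O : Set β, IsOpen O → MeasurableSet {t | (S t ∩ O).Nonempty}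

/-- The standing assumptions on the map `G` of the system `x⁺ ∈ G x v`, with state space `X ⊆ ℝⁿ`
and input space `V ⊆ ℝᵐ`. Only the values of `G` on `X × V` are relevant; they are subsets
of `X`, so that the map can be iterated. -/
structure StandingAssumptions {n m : ℕ} (X : Set (EuclideanSpace ℝ (Fin n)))
    (V : Set (EuclideanSpace ℝ (Fin m)))
    (G : EuclideanSpace ℝ (Fin n) → EuclideanSpace ℝ (Fin m) → Set (EuclideanSpace ℝ (Fin n))) :
    Prop where
  mapsTo : ∀ x ∈ X, ∀ v ∈ V, G x v ⊆ X
  usc : ∀ v ∈ V, SetValuedUSCOn (fun x => G x v) X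
  locallyBounded : SetValuedLocallyBoundedOn
    (fun p : EuclideanSpace ℝ (Fin n) × EuclideanSpace ℝ (Fin m) => G p.1 p.2) (X ×ˢ V)
  nonempty : ∀ x ∈ X, ∀ v ∈ V, (G x v).Nonempty
  closed : ∀ x ∈ X, ∀ v ∈ V, IsClosed (G x v)
  convex : ∀ x ∈ X, ∀ v ∈ V, Convex ℝ (G x v)
  measurable_graph : SetValuedMeasurable (fun v : V =>
    {p : EuclideanSpace ℝ (Fin n) × EuclideanSpace ℝ (Fin n) |
      p.1 ∈ X ∧ p.2 ∈ X ∧ p.2 ∈ G p.1 v})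

/-- The functions `λ_k^h(x, v_0, …, v_{k-1})`: `λ_0^h(x) = h(x)` and
`λ_{k+1}^h(x, v_0, …, v_k) = sup_{y ∈ G(x, v_0)} λ_k^h(y, v_1, …, v_k)`. -/
def lam {n m : ℕ}
    (G : EuclideanSpace ℝ (Fin n) → EuclideanSpace ℝ (Fin m) → Set (EuclideanSpace ℝ (Fin n)))
    (h : EuclideanSpace ℝ (Fin n) → ℝ) :
    (k : ℕ) → EuclideanSpace ℝ (Fin n) → (Fin k → EuclideanSpace ℝ (Fin m)) → ℝ
  | 0, x, _ => h x
  | k + 1, x, w => sSup ((fun y => lam G h k y (Fin.tail w)) '' G x (w 0))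

/-- For an input sequence `v`, the adversary can reach `S` from `x` within `N` steps:
`λ_k^S(x, v_0, …, v_{k-1}) ≥ 1` for some `1 ≤ k ≤ N`, `k` finite, where `λ^S` starts from the
indicator function of `S`. -/
def ReachableWithin {n m : ℕ}
    (G : EuclideanSpace ℝ (Fin n) → EuclideanSpace ℝ (Fin m) → Set (EuclideanSpace ℝ (Fin n)))
    (S : Set (EuclideanSpace ℝ (Fin n))) (N : ℕ∞) (x : EuclideanSpace ℝ (Fin n))
    (v : ℕ → EuclideanSpace ℝ (Fin m)) : Prop :=
  ∃ k : ℕ, 1 ≤ k ∧ (k : ℕ∞) ≤ N ∧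
    1 ≤ lam G (S.indicator fun _ => (1 : ℝ)) k x (fun i : Fin k => v i)

/-- Barrier function candidate on `X` with respect to `(X₀, Xᵤ)`, with levels `δ < Δ`. -/
structure IsBarrierCandidate {n : ℕ} (X X₀ Xᵤ : Set (EuclideanSpace ℝ (Fin n)))
    (B : EuclideanSpace ℝ (Fin n) → ℝ) (δ Δ : ℝ) : Prop where
  nonneg : ∀ x ∈ X, 0 ≤ B x
  usc : UpperSemicontinuousOn B X
  delta_nonneg : 0 ≤ δ
  delta_lt : δ < Δ
  le_on_initial : ∀ x ∈ X₀, B x ≤ δ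
  ge_on_unsafe : ∀ x ∈ Xᵤ, Δ ≤ B x

end

/-! Let `R k` be the set of states reachable in `k` steps and `M k` the maximum of `B` on it
(`reachSup`). Given the first `k` inputs, `R k` is a fixed compact convex set. Since the graph of
`G` is convex and `B` is concave, the next maximum is a concave function of the next input
(`concaveOn_sSup_image`), so by Jensen its mean is at most its value at the mean input. While `M k <
Δ`, the set `R k` avoids `Xᵤ`, and the hypothesis bounds that value by `M k`. Hence `M`, stopped on
reaching `Δ`, is a nonnegative supermartingale started at `B x ≤ δ`, and the maximal inequality
gives `δ / Δ`. Reaching `Xᵤ` at step `k` forces `M k ≥ Δ`.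

Two points need care. Neither `X` nor `V` is closed, so Jensen's inequality is proved for arbitrary
convex sets in finite dimension. Measurability of `M k` comes from a countable description of the
event that `R k` meets a closed set (`biUnion_inter_nonempty_iff`). -/

/-! ### Means in convex sets and Jensen's inequality -/

/-- In a nontrivial finite-dimensional space, a convex set that misses the origin lies in a closed
half-space through the origin. -/
theorem Convex.exists_ne_zero_forall_nonneg {F : Type*} [NormedAddCommGroup F] [NormedSpace ℝ F]
    [FiniteDimensional ℝ F] {C : Set F} (hC : Convex ℝ C) (hne : C.Nonempty) (h0 : (0 : F) ∉ C) :
    ∃ l : F →L[ℝ] ℝ, l ≠ 0 ∧ ∀ c ∈ C, 0 ≤ l c := by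
  by_cases hint : (interior C).Nonempty
  · obtain ⟨l, hl⟩ := geometric_hahn_banach_point_open hC.interior isOpen_interior
      (fun h => h0 (interior_subset h))
    simp only [map_zero] at hl
    refine ⟨l, ?_, fun c hc => ?_⟩
    · rintro rfl
      obtain ⟨b, hb⟩ := hint
      simpa using hl b hb
    · have hcl : c ∈ closure (interior C) := by
        rw [hC.closure_interior_eq_closure_of_nonempty_interior hint]
        exact subset_closure hc
      exact closure_minimal (fun b hb => (hl b hb).le) (isClosed_Ici.preimage l.continuous) hcl
  -- With empty interior, `C` lies in a hyperplane: some nonzero functional is constant on `C`, and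
  -- its sign can be chosen.
  · obtain ⟨c₀, hc₀⟩ := hne
    have hspan : vectorSpan ℝ C < ⊤ := by
      rw [lt_top_iff_ne_top]
      intro h
      apply hint
      rw [hC.interior_nonempty_iff_affineSpan_eq_top]
      exact (AffineSubspace.affineSpan_eq_top_iff_vectorSpan_eq_top_of_nonempty ℝ F F
        ⟨c₀, hc₀⟩).2 h
    obtain ⟨l, hl, hker⟩ := Submodule.exists_le_ker_of_lt_top _ hspan
    have hconst : ∀ c ∈ C, l c = l c₀ := fun c hc => by
      have := hker (vsub_mem_vectorSpan ℝ hc hc₀)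
      rw [LinearMap.mem_ker, vsub_eq_sub, map_sub] at this
      linarith
    have hl' : LinearMap.toContinuousLinearMap l ≠ 0 := by simpa using hl
    rcases le_total 0 (l c₀) with h | h
    · exact ⟨LinearMap.toContinuousLinearMap l, hl', fun c hc => by simpa [hconst c hc] using h⟩
    · exact ⟨-LinearMap.toContinuousLinearMap l, neg_ne_zero.2 hl', fun c hc => by
        simpa [hconst c hc] using h⟩

/-- Induction on dimension. If `0 ∉ C`, a nonzero functional that is nonnegative on `C` has mean
zero along `g`, hence vanishes almost surely there; `g` then lives in its kernel, of smaller
dimension. -/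
theorem Convex.zero_mem_of_integral_eq_zero {Ω : Type*} [MeasurableSpace Ω] (P : Measure Ω)
    [IsProbabilityMeasure P] (d : ℕ) {F : Type*} [NormedAddCommGroup F] [NormedSpace ℝ F]
    [FiniteDimensional ℝ F] (hd : Module.finrank ℝ F ≤ d) {C : Set F} (hC : Convex ℝ C)
    {g : Ω → F} (hg : Integrable g P) (hgC : ∀ᵐ ω ∂P, g ω ∈ C) (hg0 : ∫ ω, g ω ∂P = 0) :
    (0 : F) ∈ C := by
  induction d generalizing F with
  | zero =>
    have : Subsingleton F := Module.finrank_zero_iff.1 (Nat.le_zero.1 hd)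
    obtain ⟨ω, hω⟩ := hgC.exists
    rwa [Subsingleton.elim 0 (g ω)]
  | succ d ih =>
    by_contra h0
    obtain ⟨ω₀, hω₀⟩ := hgC.exists
    obtain ⟨l, hl, hlC⟩ := hC.exists_ne_zero_forall_nonneg ⟨_, hω₀⟩ h0
    have hlg : ∀ᵐ ω ∂P, l (g ω) = 0 := by
      have hnn : 0 ≤ᵐ[P] fun ω => l (g ω) := hgC.mono fun ω hω => hlC _ hω
      refine (integral_eq_zero_iff_of_nonneg_ae hnn (l.integrable_comp hg)).1 ?_
      rw [l.integral_comp_comm hg, hg0, map_zero]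
    obtain ⟨π, hπ⟩ := Submodule.ClosedComplemented.of_finiteDimensional l.ker
    have hπg : ∀ᵐ ω ∂P, ((π (g ω) : l.ker) : F) = g ω := hlg.mono fun ω hω =>
      congrArg Subtype.val (hπ ⟨g ω, hω⟩)
    have hlt : Module.finrank ℝ l.ker < Module.finrank ℝ F := by
      refine Submodule.finrank_lt fun h => hl ?_
      ext x
      have : x ∈ l.ker := h ▸ Submodule.mem_top
      exact this
    have := ih (F := l.ker) (by omega) (hC.linear_preimage l.ker.subtype)
      (π.integrable_comp hg)
      (by filter_upwards [hgC, hπg] with ω h₁ h₂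
          change ((π (g ω) : l.ker) : F) ∈ C
          rwa [h₂])
      (by rw [π.integral_comp_comm hg, hg0, map_zero])
    exact h0 this

/-- The mean of an integrable random vector with values in a convex subset of a finite-dimensional
space belongs to this set, which need not be closed. -/
theorem Convex.integral_mem_of_finiteDimensional {Ω : Type*} [MeasurableSpace Ω] {P : Measure Ω}
    [IsProbabilityMeasure P] {F : Type*} [NormedAddCommGroup F] [NormedSpace ℝ F]
    [FiniteDimensional ℝ F] {C : Set F} (hC : Convex ℝ C)
    {g : Ω → F} (hg : Integrable g P) (hgC : ∀ᵐ ω ∂P, g ω ∈ C) : ∫ ω, g ω ∂P ∈ C := by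
  have := Convex.zero_mem_of_integral_eq_zero P _ le_rfl
    (hC.translate_preimage_right (∫ ω, g ω ∂P)) (g := fun ω => g ω - ∫ ω, g ω ∂P)
    (hg.sub (integrable_const _)) (by simpa using hgC)
    (by rw [integral_sub hg (integrable_const _)]; simp)
  simpa using this

/-- Jensen's inequality for a nonnegative concave function on a convex subset of a
finite-dimensional space; neither closedness of the set nor continuity is required. -/
theorem ConcaveOn.lintegral_le_map_integral {Ω : Type*} [MeasurableSpace Ω] {P : Measure Ω}
    [IsProbabilityMeasure P] {F : Type*} [NormedAddCommGroup F] [NormedSpace ℝ F]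
    [FiniteDimensional ℝ F] {C : Set F} {f : F → ℝ} (hf : ConcaveOn ℝ C f)
    (hf0 : ∀ x ∈ C, 0 ≤ f x) {g : Ω → F} (hg : Integrable g P) (hgC : ∀ ω, g ω ∈ C)
    (hfg : Measurable fun ω => f (g ω)) :
    ∫⁻ ω, ENNReal.ofReal (f (g ω)) ∂P ≤ ENNReal.ofReal (f (∫ ω, g ω ∂P)) := by
  have htrunc : ∀ M : ℕ, ∫⁻ ω, ENNReal.ofReal (min (f (g ω)) M) ∂P ≤
      ENNReal.ofReal (f (∫ ω, g ω ∂P)) := fun M => by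
    have hnn : ∀ ω, 0 ≤ min (f (g ω)) M := fun ω => le_min (hf0 _ (hgC ω)) M.cast_nonneg
    have hint : Integrable (fun ω => min (f (g ω)) M) P :=
      Integrable.of_bound (hfg.min measurable_const).aestronglyMeasurable M
        (Filter.Eventually.of_forall fun ω => by
          rw [Real.norm_of_nonneg (hnn ω)]; exact min_le_right _ _)
    -- The pair of `g` and the truncated value lies in the convex hypograph, hence so does its mean.
    -- Truncation makes the second component integrable; monotone convergence removes it below.
    have hmem := hf.convex_hypograph.integral_mem_of_finiteDimensional (hg.prodMk hint)
      (Filter.Eventually.of_forall fun ω => ⟨hgC ω, min_le_left _ _⟩)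
    rw [integral_pair hg hint] at hmem
    rw [← ofReal_integral_eq_lintegral_ofReal hint (Filter.Eventually.of_forall hnn)]
    exact ENNReal.ofReal_le_ofReal hmem.2
  have hsup : ∀ ω, ENNReal.ofReal (f (g ω)) = ⨆ M : ℕ, ENNReal.ofReal (min (f (g ω)) M) := by
    intro ω
    refine le_antisymm ?_ (iSup_le fun M => ENNReal.ofReal_le_ofReal (min_le_left _ _))
    obtain ⟨M, hM⟩ := exists_nat_ge (f (g ω))
    exact le_iSup_of_le M (by rw [min_eq_left hM])
  simp_rw [hsup]
  rw [lintegral_iSup (fun M => (hfg.min measurable_const).ennreal_ofReal)]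
  · exact iSup_le htrunc
  · intro M M' h ω
    exact ENNReal.ofReal_le_ofReal (min_le_min le_rfl (Nat.cast_le.2 h))

/-! ### Reachable sets and their relation to `lam` -/

/-- The states that can be reached from `x` in exactly `k` steps under the input sequence `w`. -/
def reachSet {E M : Type*} (G : E → M → Set E) (x : E) : ℕ → (ℕ → M) → Set E
  | 0, _ => {x}
  | k + 1, w => ⋃ y ∈ reachSet G x k w, G y (w k)

theorem mem_reachSet_succ {E M : Type*} {G : E → M → Set E} {x z : E} {k : ℕ} {w : ℕ → M} :
    z ∈ reachSet G x (k + 1) w ↔ ∃ y ∈ reachSet G x k w, z ∈ G y (w k) := by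
  simp [reachSet]

theorem reachSet_congr {E M : Type*} {G : E → M → Set E} {x : E} {k : ℕ} {w w' : ℕ → M}
    (h : ∀ i < k, w i = w' i) : reachSet G x k w = reachSet G x k w' := by
  induction k with
  | zero => rfl
  | succ k ih =>
    ext z
    rw [mem_reachSet_succ, mem_reachSet_succ, ih fun i hi => h i (hi.trans k.lt_succ_self),
      h k k.lt_succ_self]

/-- `reachSet` appends steps at the end, whereas `lam` unfolds from the first input; this reconciles
the two recursions. -/
theorem mem_reachSet_succ_of_head {E M : Type*} {G : E → M → Set E} {x y z : E} {k : ℕ}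
    {w : ℕ → M} (hy : y ∈ G x (w 0)) (hz : z ∈ reachSet G y k (fun i => w (i + 1))) :
    z ∈ reachSet G x (k + 1) w := by
  induction k generalizing z with
  | zero =>
    obtain rfl : z = y := hz
    exact mem_reachSet_succ.2 ⟨x, rfl, hy⟩
  | succ k ih =>
    obtain ⟨z', hz', hzz'⟩ := mem_reachSet_succ.1 hz
    exact mem_reachSet_succ.2 ⟨z', ih hz', hzz'⟩

theorem reachSet_subtype {E M : Type*} {G : E → M → Set E} {V : Set M} {x : E} {k : ℕ}
    {w : ℕ → V} : reachSet G x k (fun i => (w i : M)) =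
      reachSet (fun y (u : V) => G y u) x k w := by
  induction k with
  | zero => rfl
  | succ k ih => rw [reachSet, reachSet, ih]

section lam

variable {n m : ℕ}
  {G : EuclideanSpace ℝ (Fin n) → EuclideanSpace ℝ (Fin m) → Set (EuclideanSpace ℝ (Fin n))}

theorem lam_indicator_eq_zero_of_forall_notMem {S : Set (EuclideanSpace ℝ (Fin n))} {k : ℕ}
    {x : EuclideanSpace ℝ (Fin n)} {w : ℕ → EuclideanSpace ℝ (Fin m)}
    (h : ∀ z ∈ reachSet G x k w, z ∉ S) :
    lam G (S.indicator fun _ => (1 : ℝ)) k x (fun i : Fin k => w i) = 0 := by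
  induction k generalizing x w with
  | zero => exact Set.indicator_of_notMem (h x rfl) _
  | succ k ih =>
    have hsub : (fun y => lam G (S.indicator fun _ => (1 : ℝ)) k y
        (Fin.tail fun i : Fin (k + 1) => w i)) '' G x (w 0) ⊆ {0} := by
      rintro _ ⟨y, hy, rfl⟩
      exact ih (w := fun i => w (i + 1)) fun z hz => h z (mem_reachSet_succ_of_head hy hz)
    change sSup ((fun y => lam G (S.indicator fun _ => (1 : ℝ)) k y
        (Fin.tail fun i : Fin (k + 1) => w i)) '' G x (w 0)) = 0
    -- The image may be empty, where `sSup ∅ = 0` gives the same value.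
    rcases Set.subset_singleton_iff_eq.1 hsub with h' | h' <;> rw [h'] <;> simp

theorem ReachableWithin.exists_mem_reachSet {S : Set (EuclideanSpace ℝ (Fin n))} {N : ℕ∞}
    {x : EuclideanSpace ℝ (Fin n)} {w : ℕ → EuclideanSpace ℝ (Fin m)}
    (h : ReachableWithin G S N x w) : ∃ k, ∃ z ∈ reachSet G x k w, z ∈ S := by
  obtain ⟨k, -, -, hk⟩ := h
  by_contra! hcon
  rw [lam_indicator_eq_zero_of_forall_notMem (hcon k)] at hk
  norm_num at hk

end lam

/-! ### Compactness, convexity and measurability of reachable sets -/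

namespace StandingAssumptions

variable {n m : ℕ} {X : Set (EuclideanSpace ℝ (Fin n))} {V : Set (EuclideanSpace ℝ (Fin m))}
  {G : EuclideanSpace ℝ (Fin n) → EuclideanSpace ℝ (Fin m) → Set (EuclideanSpace ℝ (Fin n))}

theorem isCompact (hG : StandingAssumptions X V G) {x : EuclideanSpace ℝ (Fin n)} (hx : x ∈ X)
    {v : EuclideanSpace ℝ (Fin m)} (hv : v ∈ V) : IsCompact (G x v) := by
  obtain ⟨U, hU, b, -, hb⟩ := hG.locallyBounded (x, v) ⟨hx, hv⟩
  refine Metric.isCompact_of_isClosed_isBounded (hG.closed x hx v hv)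
    (isBounded_iff_forall_norm_le.2 ⟨b, fun z hz => ?_⟩)
  exact hb (x, v) ⟨mem_of_mem_nhds hU, hx, hv⟩ z hz

/-- By upper semicontinuity, the distance from `t j` to its nearest point in the compact set `G a v`
tends to zero, so a convergent subsequence of the nearest points carries `t` along. -/
theorem exists_subseq_tendsto (hG : StandingAssumptions X V G) {v : EuclideanSpace ℝ (Fin m)}
    (hv : v ∈ V) {a : EuclideanSpace ℝ (Fin n)} (ha : a ∈ X) {s t : ℕ → EuclideanSpace ℝ (Fin n)}
    (hsX : ∀ j, s j ∈ X) (hs : Filter.Tendsto s Filter.atTop (𝓝 a)) (ht : ∀ j, t j ∈ G (s j) v) :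
    ∃ c ∈ G a v, ∃ φ : ℕ → ℕ, StrictMono φ ∧ Filter.Tendsto (t ∘ φ) Filter.atTop (𝓝 c) := by
  have hK := hG.isCompact ha hv
  have hne := hG.nonempty a ha v hv
  choose c hcG hc using fun j => hK.exists_infDist_eq_dist hne (t j)
  have hdist : Filter.Tendsto (fun j => dist (t j) (c j)) Filter.atTop (𝓝 0) := by
    rw [Metric.tendsto_atTop']
    intro ε hε
    obtain ⟨U, hU, hUG⟩ := hG.usc v hv a ha ε hε
    obtain ⟨N, hN⟩ := Filter.eventually_atTop.1 (hs.eventually hU)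
    refine ⟨N, fun j hj => ?_⟩
    obtain ⟨p, hp, q, hq, hpq⟩ := hUG (s j) ⟨hN j hj.le, hsX j⟩ (ht j)
    rw [Real.dist_0_eq_abs, abs_of_nonneg dist_nonneg, ← hc]
    refine (Metric.infDist_le_dist_of_mem hp).trans_lt ?_
    simp only at hpq
    rw [← hpq, dist_eq_norm, add_sub_cancel_left]
    simpa using hq
  obtain ⟨c', hc', φ, hφ, hlim⟩ := hK.tendsto_subseq hcG
  refine ⟨c', hc', φ, hφ, ?_⟩
  refine hlim.congr_dist ?_
  simpa [dist_comm, Function.comp_def] using hdist.comp hφ.tendsto_atTop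

theorem isCompact_biUnion (hG : StandingAssumptions X V G) {v : EuclideanSpace ℝ (Fin m)}
    (hv : v ∈ V) {K : Set (EuclideanSpace ℝ (Fin n))} (hK : IsCompact K) (hKX : K ⊆ X) :
    IsCompact (⋃ y ∈ K, G y v) := by
  rw [isCompact_iff_isSeqCompact]
  intro t ht
  simp only [Set.mem_iUnion, exists_prop] at ht
  choose s hsK hst using ht
  obtain ⟨a, ha, φ, hφ, hlim⟩ := hK.tendsto_subseq hsK
  obtain ⟨c, hc, ψ, hψ, hlim'⟩ := hG.exists_subseq_tendsto hv (hKX ha)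
    (fun j => hKX (hsK (φ j))) hlim (fun j => hst (φ j))
  exact ⟨c, Set.mem_biUnion ha hc, φ ∘ ψ, hφ.comp hψ, hlim'⟩

theorem reachSet_subset (hG : StandingAssumptions X V G) {x : EuclideanSpace ℝ (Fin n)}
    (hx : x ∈ X) (k : ℕ) (w : ℕ → V) : reachSet (fun y (u : V) => G y u) x k w ⊆ X := by
  induction k with
  | zero => rintro _ rfl; exact hx
  | succ k ih => exact Set.iUnion₂_subset fun y hy => hG.mapsTo y (ih hy) _ (w k).2

theorem reachSet_nonempty (hG : StandingAssumptions X V G) {x : EuclideanSpace ℝ (Fin n)}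
    (hx : x ∈ X) (k : ℕ) (w : ℕ → V) : (reachSet (fun y (u : V) => G y u) x k w).Nonempty := by
  induction k with
  | zero => exact ⟨x, rfl⟩
  | succ k ih =>
    obtain ⟨y, hy⟩ := ih
    obtain ⟨z, hz⟩ := hG.nonempty y (hG.reachSet_subset hx k w hy) _ (w k).2
    exact ⟨z, mem_reachSet_succ.2 ⟨y, hy, hz⟩⟩

theorem isCompact_reachSet (hG : StandingAssumptions X V G) {x : EuclideanSpace ℝ (Fin n)}
    (hx : x ∈ X) (k : ℕ) (w : ℕ → V) : IsCompact (reachSet (fun y (u : V) => G y u) x k w) := by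
  induction k with
  | zero => exact isCompact_singleton
  | succ k ih => exact hG.isCompact_biUnion (w k).2 ih (hG.reachSet_subset hx k w)

theorem convex_reachSet (hG : StandingAssumptions X V G)
    (hGconv : SetValuedConvexOn
      (fun p : EuclideanSpace ℝ (Fin n) × EuclideanSpace ℝ (Fin m) => G p.1 p.2) (X ×ˢ V))
    {x : EuclideanSpace ℝ (Fin n)} (hx : x ∈ X) (k : ℕ) (w : ℕ → V) :
    Convex ℝ (reachSet (fun y (u : V) => G y u) x k w) := by
  induction k with
  | zero => exact convex_singleton x
  | succ k ih =>
    intro z₁ hz₁ z₂ hz₂ a b ha hb hab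
    obtain ⟨y₁, hy₁, hz₁⟩ := mem_reachSet_succ.1 hz₁
    obtain ⟨y₂, hy₂, hz₂⟩ := mem_reachSet_succ.1 hz₂
    have hsub := hG.reachSet_subset hx k w
    have h := hGconv (x := ((y₁, w k), z₁)) ⟨⟨hsub hy₁, (w k).2⟩, hz₁⟩
      (y := ((y₂, w k), z₂)) ⟨⟨hsub hy₂, (w k).2⟩, hz₂⟩ ha hb hab
    refine mem_reachSet_succ.2 ⟨a • y₁ + b • y₂, ih hy₁ hy₂ ha hb hab, ?_⟩
    have h2 : a • z₁ + b • z₂ ∈ G (a • y₁ + b • y₂) (a • (w k : EuclideanSpace ℝ (Fin m)) +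
      b • (w k : EuclideanSpace ℝ (Fin m))) := h.2
    rwa [← add_smul, hab, one_smul] at h2

/-- A countable criterion, in terms of the open sets met by the graph of `G (·, v)`, for the image
of a compact set under `G (·, v)` to meet a closed set. -/
theorem biUnion_inter_nonempty_iff (hG : StandingAssumptions X V G)
    {v : EuclideanSpace ℝ (Fin m)} (hv : v ∈ V) {K C : Set (EuclideanSpace ℝ (Fin n))}
    (hK : IsCompact K) (hKX : K ⊆ X) (hC : IsClosed C) :
    ((⋃ y ∈ K, G y v) ∩ C).Nonempty ↔ ∀ j : ℕ, ∃ q : ℕ × ℕ,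
      (K ∩ Metric.closedBall (TopologicalSpace.denseSeq _ q.1) (1 / ((j : ℝ) + 1))).Nonempty ∧
      (C ∩ Metric.closedBall (TopologicalSpace.denseSeq _ q.2) (1 / ((j : ℝ) + 1))).Nonempty ∧
      ({p : EuclideanSpace ℝ (Fin n) × EuclideanSpace ℝ (Fin n) |
        p.1 ∈ X ∧ p.2 ∈ X ∧ p.2 ∈ G p.1 v} ∩
        Metric.ball (TopologicalSpace.denseSeq _ q.1) (1 / ((j : ℝ) + 1)) ×ˢ
          Metric.ball (TopologicalSpace.denseSeq _ q.2) (1 / ((j : ℝ) + 1))).Nonempty := by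
  constructor
  · rintro ⟨z, hz, hzC⟩ j
    simp only [Set.mem_iUnion, exists_prop] at hz
    obtain ⟨y, hyK, hz⟩ := hz
    have hj : (0 : ℝ) < 1 / ((j : ℝ) + 1) := Nat.one_div_pos_of_nat
    obtain ⟨q₁, hq₁⟩ := (TopologicalSpace.denseRange_denseSeq _).exists_dist_lt y hj
    obtain ⟨q₂, hq₂⟩ := (TopologicalSpace.denseRange_denseSeq _).exists_dist_lt z hj
    exact ⟨(q₁, q₂), ⟨y, hyK, hq₁.le⟩, ⟨z, hzC, hq₂.le⟩,
      ⟨(y, z), ⟨hKX hyK, hG.mapsTo y (hKX hyK) v hv hz, hz⟩, hq₁, hq₂⟩⟩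
  · intro h
    choose q a c p using h
    choose a ha using a
    choose c hc using c
    choose p hp using p
    have h0 : Filter.Tendsto (fun j : ℕ => 1 / ((j : ℝ) + 1) + 1 / ((j : ℝ) + 1))
        Filter.atTop (𝓝 0) := by
      simpa using tendsto_one_div_add_atTop_nhds_zero_nat.add
        (tendsto_one_div_add_atTop_nhds_zero_nat (𝕜 := ℝ))
    -- Points of `K` and of `C` share balls of radius `1 / (j + 1)` with the two components of a
    -- graph point, so the gaps are at most twice that radius.
    have hap : Filter.Tendsto (fun j => dist (a j) (p j).1) Filter.atTop (𝓝 0) :=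
      squeeze_zero (fun _ => dist_nonneg) (fun j => (dist_triangle_right _ _ _).trans
        (add_le_add (ha j).2 (hp j).2.1.le)) h0
    have hcp : Filter.Tendsto (fun j => dist (p j).2 (c j)) Filter.atTop (𝓝 0) :=
      squeeze_zero (fun _ => dist_nonneg) (fun j => (dist_triangle_right _ _ _).trans
        (add_le_add (hp j).2.2.le (hc j).2)) h0
    obtain ⟨a', ha', φ, hφ, hlim⟩ := hK.tendsto_subseq fun j => (ha j).1
    obtain ⟨c', hc', ψ, hψ, hlim'⟩ := hG.exists_subseq_tendsto hv (hKX ha')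
      (fun j => (hp (φ j)).1.1) (hlim.congr_dist (hap.comp hφ.tendsto_atTop))
      (fun j => (hp (φ j)).1.2.2)
    refine ⟨c', Set.mem_biUnion ha' hc', hC.mem_of_tendsto
      (hlim'.congr_dist (hcp.comp (hφ.comp hψ).tendsto_atTop))
      (Filter.Eventually.of_forall fun j => (hc _).1)⟩

/-- The criterion reduces step `k + 1` to countably many events: step `k` meeting a closed ball,
which is why the induction ranges over all closed sets, and the graph at input `w k` meeting an open
box. -/
theorem measurableSet_reachSet_inter_nonempty (hG : StandingAssumptions X V G)
    {x : EuclideanSpace ℝ (Fin n)} (hx : x ∈ X) (k : ℕ) {C : Set (EuclideanSpace ℝ (Fin n))}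
    (hC : IsClosed C) : MeasurableSet
      {w : ℕ → V | (reachSet (fun y (u : V) => G y u) x k w ∩ C).Nonempty} := by
  induction k generalizing C with
  | zero =>
    have : {w : ℕ → V | (reachSet (fun y (u : V) => G y u) x 0 w ∩ C).Nonempty} =
        {_w : ℕ → V | x ∈ C} := by
      ext w; simp [reachSet]
    rw [this]
    exact MeasurableSet.const _
  | succ k ih =>
    have := fun w : ℕ → V => hG.biUnion_inter_nonempty_iff (w k).2
      (hG.isCompact_reachSet hx k w) (hG.reachSet_subset hx k w) hC
    simp only [reachSet, this]
    simp only [Set.ofPred_forall, Set.ofPred_exists, Set.ofPred_and]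
    refine MeasurableSet.iInter fun j => MeasurableSet.iUnion fun q => ?_
    refine (ih Metric.isClosed_closedBall).inter ((MeasurableSet.const _).inter ?_)
    have hgraph := hG.measurable_graph
      (Metric.ball (TopologicalSpace.denseSeq _ q.1) (1 / ((j : ℝ) + 1)) ×ˢ
        Metric.ball (TopologicalSpace.denseSeq _ q.2) (1 / ((j : ℝ) + 1)))
      (Metric.isOpen_ball.prod Metric.isOpen_ball)
    exact (measurable_pi_apply (X := fun _ : ℕ => V) k) hgraph

end StandingAssumptions

/-! ### Integrating out one coordinate of an independent sequence -/

/-- For an independent sequence `v` with common law `μ`: if averaging `g` over its `k`-th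
coordinate gives at most `h`, where `g` depends on the coordinates `0, …, k` and `h` on the
coordinates `0, …, k - 1`, then the mean of `g` along `v` is at most that of `h`. -/
theorem lintegral_comp_le_of_forall_lintegral_update_le {M Ω : Type*} [MeasurableSpace M]
    [MeasurableSpace Ω] {P : Measure Ω} [IsProbabilityMeasure P] {μ : Measure M} {v : ℕ → Ω → M}
    (hv_meas : ∀ i, Measurable (v i)) (hv_indep : iIndepFun v P) (hv_law : ∀ i, P.map (v i) = μ)
    {k : ℕ} {g h : (ℕ → M) → ENNReal} (hg : Measurable g) (hh : Measurable h)
    (hgdep : ∀ w w' : ℕ → M, (∀ i < k + 1, w i = w' i) → g w = g w')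
    (hhdep : ∀ w w' : ℕ → M, (∀ i < k, w i = w' i) → h w = h w')
    (hle : ∀ w, ∫⁻ u, g (Function.update w k u) ∂μ ≤ h w) :
    ∫⁻ ω, g (fun i => v i ω) ∂P ≤ ∫⁻ ω, h (fun i => v i ω) ∂P := by
  obtain ⟨ω₀⟩ : Nonempty Ω := nonempty_of_isProbabilityMeasure P
  have : IsProbabilityMeasure μ := hv_law 0 ▸ Measure.isProbabilityMeasure_map
    (hv_meas 0).aemeasurable
  let W : Ω → (Finset.range k → M) := fun ω i => v i ω
  have hW : Measurable W := measurable_pi_lambda _ fun i => hv_meas i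
  have hWp : IsProbabilityMeasure (P.map W) := Measure.isProbabilityMeasure_map hW.aemeasurable
  have hind : IndepFun W (v k) P :=
    (hv_indep.indepFun_finset (Finset.range k) {k} (by simp) hv_meas).comp measurable_id
      (measurable_pi_apply (⟨k, Finset.mem_singleton_self k⟩ : ({k} : Finset ℕ)))
  -- The second component fills every index from `k` on; `g` sees it only at `k` and `h` not at all,
  -- so the filler `u₀` below is arbitrary.
  let e : (Finset.range k → M) × M → ℕ → M := fun p i =>
    if hi : i ∈ Finset.range k then p.1 ⟨i, hi⟩ else p.2
  have he : Measurable e := by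
    refine measurable_pi_lambda _ fun i => ?_
    by_cases hi : i ∈ Finset.range k
    · simp only [e, hi, dif_pos]
      exact (measurable_pi_apply _).comp measurable_fst
    · simp only [e, hi, dif_neg, not_false_eq_true]
      exact measurable_snd
  have helt : ∀ p, ∀ i (hi : i < k), e p i = p.1 ⟨i, Finset.mem_range.2 hi⟩ := fun p i hi => by
    simp [e, hi]
  have hege : ∀ p, e p k = p.2 := fun p => by simp [e]
  let u₀ : M := v 0 ω₀
  calc ∫⁻ ω, g (fun i => v i ω) ∂P = ∫⁻ ω, g (e (W ω, v k ω)) ∂P := by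
        refine lintegral_congr fun ω => hgdep _ _ fun i hi => ?_
        rcases Nat.lt_succ_iff_lt_or_eq.1 hi with hi | rfl
        · rw [helt _ _ hi]
        · rw [hege]
    _ = ∫⁻ p, g (e p) ∂(P.map fun ω => (W ω, v k ω)) :=
        (lintegral_map (hg.comp he) (hW.prodMk (hv_meas k))).symm
    _ = ∫⁻ y, ∫⁻ u, g (e (y, u)) ∂μ ∂(P.map W) := by
        rw [hind.map_prod_eq_prod_map_map hW.aemeasurable (hv_meas k).aemeasurable, hv_law k]
        exact lintegral_prod _ (hg.comp he).aemeasurable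
    _ ≤ ∫⁻ y, h (e (y, u₀)) ∂(P.map W) := by
        refine lintegral_mono fun y => le_trans (le_of_eq ?_) (hle (e (y, u₀)))
        refine lintegral_congr fun u => hgdep _ _ fun i hi => ?_
        rcases Nat.lt_succ_iff_lt_or_eq.1 hi with hi | rfl
        · rw [Function.update_of_ne hi.ne, helt _ _ hi, helt _ _ hi]
        · rw [Function.update_self, hege]
    _ = ∫⁻ ω, h (e (W ω, u₀)) ∂P :=
        lintegral_map (hh.comp (he.comp (measurable_id.prodMk measurable_const))) hW
    _ = ∫⁻ ω, h (fun i => v i ω) ∂P :=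
        lintegral_congr fun ω => hhdep _ _ fun i hi => helt _ _ hi

/-! ### The maximum of `B` over reachable states as a supermartingale -/

section

variable {n m : ℕ} {X : Set (EuclideanSpace ℝ (Fin n))} {V : Set (EuclideanSpace ℝ (Fin m))}
  {G : EuclideanSpace ℝ (Fin n) → EuclideanSpace ℝ (Fin m) → Set (EuclideanSpace ℝ (Fin n))}
  {B : EuclideanSpace ℝ (Fin n) → ℝ}

/-- The largest value of `B` over the states reachable from `x` in `k` steps. -/
noncomputable def reachSup (V : Set (EuclideanSpace ℝ (Fin m)))
    (G : EuclideanSpace ℝ (Fin n) → EuclideanSpace ℝ (Fin m) → Set (EuclideanSpace ℝ (Fin n)))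
    (B : EuclideanSpace ℝ (Fin n) → ℝ) (x : EuclideanSpace ℝ (Fin n)) (k : ℕ) (w : ℕ → V) : ℝ :=
  sSup (B '' reachSet (fun y (u : V) => G y u) x k w)

theorem reachSup_zero (x : EuclideanSpace ℝ (Fin n)) (w : ℕ → V) : reachSup V G B x 0 w = B x := by
  simp [reachSup, reachSet]

theorem reachSup_congr {x : EuclideanSpace ℝ (Fin n)} {k : ℕ} {w w' : ℕ → V}
    (h : ∀ i < k, w i = w' i) : reachSup V G B x k w = reachSup V G B x k w' := by
  rw [reachSup, reachSup, reachSet_congr h]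

theorem StandingAssumptions.le_reachSup (hG : StandingAssumptions X V G)
    (hB : UpperSemicontinuousOn B X) {x : EuclideanSpace ℝ (Fin n)} (hx : x ∈ X) {k : ℕ}
    {w : ℕ → V} {z : EuclideanSpace ℝ (Fin n)}
    (hz : z ∈ reachSet (fun y (u : V) => G y u) x k w) : B z ≤ reachSup V G B x k w :=
  le_csSup ((hB.mono (hG.reachSet_subset hx k w)).bddAbove_of_isCompact
    (hG.isCompact_reachSet hx k w)) ⟨z, hz, rfl⟩

theorem StandingAssumptions.exists_eq_reachSup (hG : StandingAssumptions X V G)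
    (hB : UpperSemicontinuousOn B X) {x : EuclideanSpace ℝ (Fin n)} (hx : x ∈ X) (k : ℕ)
    (w : ℕ → V) : ∃ z ∈ reachSet (fun y (u : V) => G y u) x k w, B z = reachSup V G B x k w := by
  obtain ⟨z, hz, hmax⟩ := (hB.mono (hG.reachSet_subset hx k w)).exists_isMaxOn
    (hG.reachSet_nonempty hx k w) (hG.isCompact_reachSet hx k w)
  refine ⟨z, hz, le_antisymm (hG.le_reachSup hB hx hz) (csSup_le ⟨_, z, hz, rfl⟩ ?_)⟩
  rintro _ ⟨y, hy, rfl⟩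
  exact hmax hy

/-- Because the maximum is attained, it is at least `c` exactly when the reachable set meets the
relatively closed set where `B ≥ c`. -/
theorem StandingAssumptions.measurable_reachSup (hG : StandingAssumptions X V G)
    (hB : UpperSemicontinuousOn B X) {x : EuclideanSpace ℝ (Fin n)} (hx : x ∈ X) (k : ℕ) :
    Measurable (reachSup V G B x k) := by
  refine measurable_of_Ici fun c => ?_
  obtain ⟨C, hC, hXC⟩ := upperSemicontinuousOn_iff_preimage_Ici.1 hB c
  convert hG.measurableSet_reachSet_inter_nonempty hx k hC using 1
  ext w
  have hiff : ∀ z ∈ X, c ≤ B z ↔ z ∈ C := fun z hz => by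
    have := Set.ext_iff.1 hXC z
    simpa [hz] using this
  constructor
  · intro h
    obtain ⟨z, hz, hBz⟩ := hG.exists_eq_reachSup hB hx k w
    exact ⟨z, hz, (hiff z (hG.reachSet_subset hx k w hz)).1 (hBz ▸ h)⟩
  · rintro ⟨z, hz, hzC⟩
    exact ((hiff z (hG.reachSet_subset hx k w hz)).2 hzC).trans (hG.le_reachSup hB hx hz)

/-- Maximising transitions for two inputs combine, by convexity of the graph and of `K`, into an
admissible transition for the combined input; concavity of `B` compares the values. -/
theorem StandingAssumptions.concaveOn_sSup_image (hG : StandingAssumptions X V G)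
    (hGconv : SetValuedConvexOn
      (fun p : EuclideanSpace ℝ (Fin n) × EuclideanSpace ℝ (Fin m) => G p.1 p.2) (X ×ˢ V))
    (hB : UpperSemicontinuousOn B X) (hBconc : ConcaveOn ℝ X B)
    {K : Set (EuclideanSpace ℝ (Fin n))} (hK : IsCompact K) (hKconv : Convex ℝ K) (hKX : K ⊆ X)
    (hKne : K.Nonempty) :
    ConcaveOn ℝ V fun u => sSup (B '' ⋃ y ∈ K, G y u) := by
  obtain ⟨y₀, hy₀⟩ := hKne
  have hmem : ∀ {u z}, z ∈ ⋃ y ∈ K, G y u ↔ ∃ y ∈ K, z ∈ G y u := by simp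
  have hsubX : ∀ u ∈ V, (⋃ y ∈ K, G y u) ⊆ X := fun u hu =>
    Set.iUnion₂_subset fun y hy => hG.mapsTo y (hKX hy) u hu
  have hVconv : Convex ℝ V := fun u₁ hu₁ u₂ hu₂ a b ha hb hab => by
    obtain ⟨z₁, hz₁⟩ := hG.nonempty y₀ (hKX hy₀) u₁ hu₁
    obtain ⟨z₂, hz₂⟩ := hG.nonempty y₀ (hKX hy₀) u₂ hu₂
    exact (hGconv (x := ((y₀, u₁), z₁)) ⟨⟨hKX hy₀, hu₁⟩, hz₁⟩
      (y := ((y₀, u₂), z₂)) ⟨⟨hKX hy₀, hu₂⟩, hz₂⟩ ha hb hab).1.2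
  have hmax : ∀ u ∈ V, ∃ y ∈ K, ∃ z ∈ G y u, sSup (B '' ⋃ y ∈ K, G y u) ≤ B z := fun u hu => by
    obtain ⟨z₀, hz₀⟩ := hG.nonempty y₀ (hKX hy₀) u hu
    have hne : (⋃ y ∈ K, G y u).Nonempty := ⟨z₀, hmem.2 ⟨y₀, hy₀, hz₀⟩⟩
    obtain ⟨z, hz, hzmax⟩ := (hB.mono (hsubX u hu)).exists_isMaxOn hne
      (hG.isCompact_biUnion hu hK hKX)
    obtain ⟨y, hy, hzy⟩ := hmem.1 hz
    refine ⟨y, hy, z, hzy, csSup_le (hne.image B) ?_⟩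
    rintro _ ⟨z', hz', rfl⟩
    exact hzmax hz'
  refine ⟨hVconv, fun u₁ hu₁ u₂ hu₂ a b ha hb hab => ?_⟩
  obtain ⟨y₁, hy₁, z₁, hz₁, h₁⟩ := hmax u₁ hu₁
  obtain ⟨y₂, hy₂, z₂, hz₂, h₂⟩ := hmax u₂ hu₂
  have hgraph := (hGconv (x := ((y₁, u₁), z₁)) ⟨⟨hKX hy₁, hu₁⟩, hz₁⟩
    (y := ((y₂, u₂), z₂)) ⟨⟨hKX hy₂, hu₂⟩, hz₂⟩ ha hb hab).2
  have huV := hVconv hu₁ hu₂ ha hb hab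
  calc a • sSup (B '' ⋃ y ∈ K, G y u₁) + b • sSup (B '' ⋃ y ∈ K, G y u₂)
      ≤ a • B z₁ + b • B z₂ := by
        simp only [smul_eq_mul]; gcongr
    _ ≤ B (a • z₁ + b • z₂) := hBconc.2 (hG.mapsTo _ (hKX hy₁) _ hu₁ hz₁)
        (hG.mapsTo _ (hKX hy₂) _ hu₂ hz₂) ha hb hab
    _ ≤ sSup (B '' ⋃ y ∈ K, G y (a • u₁ + b • u₂)) :=
        le_csSup ((hB.mono (hsubX _ huV)).bddAbove_of_isCompact
          (hG.isCompact_biUnion huV hK hKX))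
          ⟨_, hmem.2 ⟨_, hKconv hy₁ hy₂ ha hb hab, hgraph⟩, rfl⟩

/-- The supermartingale inequality for `reachSup`, as long as the level `Δ` is not attained. -/
theorem StandingAssumptions.lintegral_reachSup_update_le (hG : StandingAssumptions X V G)
    (hGconv : SetValuedConvexOn
      (fun p : EuclideanSpace ℝ (Fin n) × EuclideanSpace ℝ (Fin m) => G p.1 p.2) (X ×ˢ V))
    {μ : Measure V} [IsProbabilityMeasure μ]
    (hμ : Integrable (fun u : V => (u : EuclideanSpace ℝ (Fin m))) μ)
    (hB : UpperSemicontinuousOn B X) (hB0 : ∀ x ∈ X, 0 ≤ B x) (hBconc : ConcaveOn ℝ X B) {Δ : ℝ}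
    (hsup : ∀ x ∈ X, B x < Δ →
      sSup (B '' G x (∫ u : V, (u : EuclideanSpace ℝ (Fin m)) ∂μ)) ≤ B x)
    {x : EuclideanSpace ℝ (Fin n)} (hx : x ∈ X) (k : ℕ) (w : ℕ → V)
    (hw : reachSup V G B x k w < Δ) :
    ∫⁻ u, ENNReal.ofReal (reachSup V G B x (k + 1) (Function.update w k u)) ∂μ ≤
      ENNReal.ofReal (reachSup V G B x k w) := by
  set K := reachSet (fun y (u : V) => G y u) x k w with hKdef
  have hK : IsCompact K := hG.isCompact_reachSet hx k w
  have hKX : K ⊆ X := hG.reachSet_subset hx k w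
  have hKne : K.Nonempty := hG.reachSet_nonempty hx k w
  have hconc := hG.concaveOn_sSup_image hGconv hB hBconc hK
    (hG.convex_reachSet hGconv hx k w) hKX hKne
  have heq : ∀ u : V, reachSup V G B x (k + 1) (Function.update w k u) =
      sSup (B '' ⋃ y ∈ K, G y u) := fun u => by
    rw [reachSup, reachSet, reachSet_congr (w' := w) fun i hi => Function.update_of_ne hi.ne _ _,
      Function.update_self]
  have hmeas : Measurable fun u : V => sSup (B '' ⋃ y ∈ K, G y u) := by
    simp only [← heq]
    exact (hG.measurable_reachSup hB hx (k + 1)).comp (measurable_update w)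
  have hmean : ∫ u : V, (u : EuclideanSpace ℝ (Fin m)) ∂μ ∈ V :=
    hconc.1.integral_mem_of_finiteDimensional hμ (Filter.Eventually.of_forall fun u => u.2)
  simp only [heq]
  refine (hconc.lintegral_le_map_integral (fun u hu => Real.sSup_nonneg ?_) hμ
    (fun u => u.2) hmeas).trans (ENNReal.ofReal_le_ofReal ?_)
  · rintro _ ⟨z, hz, rfl⟩
    simp only [Set.mem_iUnion, exists_prop] at hz
    obtain ⟨y, hy, hz⟩ := hz
    exact hB0 z (hG.mapsTo y (hKX hy) u hu hz)
  · obtain ⟨y₀, hy₀⟩ := hKne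
    obtain ⟨z₀, hz₀⟩ := hG.nonempty y₀ (hKX hy₀) _ hmean
    refine csSup_le ⟨_, z₀, Set.mem_biUnion hy₀ hz₀, rfl⟩ ?_
    rintro _ ⟨z, hz, rfl⟩
    simp only [Set.mem_iUnion, exists_prop] at hz
    obtain ⟨y, hy, hz⟩ := hz
    have hyle : B y ≤ reachSup V G B x k w := hG.le_reachSup hB hx hy
    have hbdd : BddAbove (B '' G y (∫ u : V, (u : EuclideanSpace ℝ (Fin m)) ∂μ)) :=
      (hB.mono (hG.mapsTo y (hKX hy) _ hmean)).bddAbove_of_isCompact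
        (hG.isCompact (hKX hy) hmean)
    exact (le_csSup hbdd ⟨z, hz, rfl⟩).trans
      ((hsup y (hKX hy) (hyle.trans_lt hw)).trans hyle)

/-- Maximal inequality: the probability that `reachSup` attains the level `Δ` within `k` steps. -/
theorem StandingAssumptions.mul_measure_add_lintegral_le (hG : StandingAssumptions X V G)
    (hGconv : SetValuedConvexOn
      (fun p : EuclideanSpace ℝ (Fin n) × EuclideanSpace ℝ (Fin m) => G p.1 p.2) (X ×ˢ V))
    {Ω : Type*} [MeasurableSpace Ω] {P : Measure Ω} [IsProbabilityMeasure P]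
    {μ : Measure V} {v : ℕ → Ω → V} (hv_meas : ∀ i, Measurable (v i))
    (hv_indep : iIndepFun v P) (hv_law : ∀ i, P.map (v i) = μ)
    (hμ : Integrable (fun u : V => (u : EuclideanSpace ℝ (Fin m))) μ)
    (hB : UpperSemicontinuousOn B X) (hB0 : ∀ x ∈ X, 0 ≤ B x) (hBconc : ConcaveOn ℝ X B) {Δ : ℝ}
    (hsup : ∀ x ∈ X, B x < Δ →
      sSup (B '' G x (∫ u : V, (u : EuclideanSpace ℝ (Fin m)) ∂μ)) ≤ B x)
    {x : EuclideanSpace ℝ (Fin n)} (hx : x ∈ X) (hxΔ : B x < Δ) (k : ℕ) :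
    ENNReal.ofReal Δ * P {ω | ∃ i ≤ k, Δ ≤ reachSup V G B x i (fun j => v j ω)} +
      ∫⁻ ω in {ω | ∃ i ≤ k, Δ ≤ reachSup V G B x i (fun j => v j ω)}ᶜ,
        ENNReal.ofReal (reachSup V G B x k (fun j => v j ω)) ∂P ≤ ENNReal.ofReal (B x) := by
  have : IsProbabilityMeasure μ := hv_law 0 ▸ Measure.isProbabilityMeasure_map
    (hv_meas 0).aemeasurable
  have hR := hG.measurable_reachSup hB hx
  have hvm : Measurable fun ω i => v i ω := measurable_pi_lambda _ hv_meas
  let A : ℕ → Set (ℕ → V) := fun k => {w | ∃ i ≤ k, Δ ≤ reachSup V G B x i w}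
  have hA : ∀ k, MeasurableSet (A k) := fun k => by
    have : A k = ⋃ i ≤ k, reachSup V G B x i ⁻¹' Set.Ici Δ := by ext w; simp [A]
    rw [this]
    exact MeasurableSet.iUnion fun i => MeasurableSet.iUnion fun _ => hR i measurableSet_Ici
  let T : ℕ → Set Ω := fun k => {ω | ∃ i ≤ k, Δ ≤ reachSup V G B x i (fun j => v j ω)}
  have hT : ∀ k, MeasurableSet (T k) := fun k => hvm (hA k)
  change ENNReal.ofReal Δ * P (T k) + ∫⁻ ω in (T k)ᶜ, _ ∂P ≤ _
  -- The integral over the paths not yet stopped is what lets the induction close.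
  induction k with
  | zero =>
    have hT0 : T 0 = ∅ := by ext ω; simp [T, reachSup_zero, hxΔ]
    simp [hT0, reachSup_zero]
  | succ k ih =>
    have hmono : T k ⊆ T (k + 1) := fun ω ⟨i, hi, h⟩ => ⟨i, hi.trans k.le_succ, h⟩
    have hstep : ∫⁻ ω in (T k)ᶜ, ENNReal.ofReal (reachSup V G B x (k + 1) fun j => v j ω) ∂P ≤
        ∫⁻ ω in (T k)ᶜ, ENNReal.ofReal (reachSup V G B x k fun j => v j ω) ∂P := by
      rw [← lintegral_indicator (hT k).compl, ← lintegral_indicator (hT k).compl]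
      -- Not having stopped by time `k` is decided by the inputs before `k`, so its indicator is
      -- constant when input `k` is averaged.
      have hAdep : ∀ w w' : ℕ → V, (∀ i < k, w i = w' i) → (w ∈ (A k)ᶜ ↔ w' ∈ (A k)ᶜ) := by
        intro w w' h
        simp only [A, Set.mem_compl_iff]
        refine not_congr (exists_congr fun i => and_congr_right fun hi => ?_)
        rw [reachSup_congr fun j hj => h j (hj.trans_le hi)]
      refine lintegral_comp_le_of_forall_lintegral_update_le hv_meas hv_indep hv_law (k := k)
        (g := (A k)ᶜ.indicator fun w => ENNReal.ofReal (reachSup V G B x (k + 1) w))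
        (h := (A k)ᶜ.indicator fun w => ENNReal.ofReal (reachSup V G B x k w))
        ((hR (k + 1)).ennreal_ofReal.indicator (hA k).compl)
        ((hR k).ennreal_ofReal.indicator (hA k).compl) ?_ ?_ ?_
      · intro w w' h
        have := hAdep w w' fun i hi => h i (hi.trans k.lt_succ_self)
        by_cases hw : w ∈ (A k)ᶜ
        · rw [Set.indicator_of_mem hw, Set.indicator_of_mem (this.1 hw), reachSup_congr h]
        · rw [Set.indicator_of_notMem hw, Set.indicator_of_notMem (mt this.2 hw)]
      · intro w w' h
        have := hAdep w w' h
        by_cases hw : w ∈ (A k)ᶜ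
        · rw [Set.indicator_of_mem hw, Set.indicator_of_mem (this.1 hw), reachSup_congr h]
        · rw [Set.indicator_of_notMem hw, Set.indicator_of_notMem (mt this.2 hw)]
      · intro w
        have hupd : ∀ u, w ∈ (A k)ᶜ ↔ Function.update w k u ∈ (A k)ᶜ := fun u =>
          hAdep _ _ fun i hi => (Function.update_of_ne hi.ne _ _).symm
        by_cases hw : w ∈ (A k)ᶜ
        · rw [Set.indicator_of_mem hw,
            lintegral_congr fun u => Set.indicator_of_mem ((hupd u).1 hw) _]
          refine hG.lintegral_reachSup_update_le hGconv hμ hB hB0 hBconc hsup hx k w ?_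
          by_contra! hcon
          exact hw ⟨k, le_rfl, hcon⟩
        · rw [lintegral_congr fun u => Set.indicator_of_notMem (mt (hupd u).2 hw) _]
          simp
    have hsplit : (T k)ᶜ = (T (k + 1) \ T k) ∪ (T (k + 1))ᶜ := by
      ext ω
      have := @hmono ω
      simp only [Set.mem_compl_iff, Set.mem_union, Set.mem_sdiff]
      tauto
    have hnew : ENNReal.ofReal Δ * P (T (k + 1) \ T k) ≤
        ∫⁻ ω in T (k + 1) \ T k, ENNReal.ofReal (reachSup V G B x (k + 1) fun j => v j ω) ∂P := by
      rw [← setLIntegral_const]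
      refine setLIntegral_mono' ((hT (k + 1)).diff (hT k)) ?_
      rintro ω ⟨⟨i, hi, h⟩, hnot⟩
      refine ENNReal.ofReal_le_ofReal ?_
      rcases Nat.le_succ_iff.1 hi with hi' | rfl
      · exact absurd ⟨i, hi', h⟩ hnot
      · exact h
    rw [hsplit, lintegral_union (hT (k + 1)).compl
      (disjoint_compl_right.mono_left Set.sdiff_subset)] at hstep
    have hP : P (T (k + 1)) = P (T k) + P (T (k + 1) \ T k) := by
      rw [← measure_union Set.disjoint_sdiff_right ((hT (k + 1)).diff (hT k)),
        Set.union_sdiff_cancel hmono]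
    calc ENNReal.ofReal Δ * P (T (k + 1)) + _
        = ENNReal.ofReal Δ * P (T k) + (ENNReal.ofReal Δ * P (T (k + 1) \ T k) + _) := by
          rw [hP, mul_add, add_assoc]
      _ ≤ ENNReal.ofReal Δ * P (T k) + _ := by
          gcongr
          exact (add_le_add_left hnew _).trans hstep
      _ ≤ _ := hsplit ▸ ih

end

/-! ### The barrier bound -/

theorem mainTheorem1 {n m : ℕ}
    (X : Set (EuclideanSpace ℝ (Fin n))) (V : Set (EuclideanSpace ℝ (Fin m)))
    (G : EuclideanSpace ℝ (Fin n) → EuclideanSpace ℝ (Fin m) → Set (EuclideanSpace ℝ (Fin n)))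
    (hG : StandingAssumptions X V G)
    (hGconv : SetValuedConvexOn
      (fun p : EuclideanSpace ℝ (Fin n) × EuclideanSpace ℝ (Fin m) => G p.1 p.2) (X ×ˢ V))
    -- i.i.d. inputs with common law `μ` on `V` and finite mean
    {Ω : Type*} [MeasurableSpace Ω] (P : Measure Ω) [IsProbabilityMeasure P]
    (μ : Measure V) (v : ℕ → Ω → V) (hv_meas : ∀ i, Measurable (v i))
    (hv_indep : iIndepFun v P) (hv_law : ∀ i, P.map (v i) = μ)
    (hμ : Integrable (fun u : V => (u : EuclideanSpace ℝ (Fin m))) μ)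
    (X₀ Xᵤ : Set (EuclideanSpace ℝ (Fin n))) (hX₀ : X₀ ⊆ X) (hXᵤ : Xᵤ ⊆ X)
    (B : EuclideanSpace ℝ (Fin n) → ℝ) (δ Δ : ℝ)
    (hB : IsBarrierCandidate X X₀ Xᵤ B δ Δ) (hBconc : ConcaveOn ℝ X B)
    (hsup : ∀ x ∈ X \ Xᵤ,
      sSup (B '' G x (∫ u : V, (u : EuclideanSpace ℝ (Fin m)) ∂μ)) ≤ B x) :
    ∀ N : ℕ∞, ∀ x ∈ X₀,
      P {ω | ReachableWithin G Xᵤ N x (fun i => (v i ω : EuclideanSpace ℝ (Fin m)))}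
        ≤ ENNReal.ofReal (δ / Δ) := by
  intro N x hx₀
  have hx := hX₀ hx₀
  have hxδ := hB.le_on_initial x hx₀
  have hΔ : 0 < Δ := hB.delta_nonneg.trans_lt hB.delta_lt
  let T : ℕ → Set Ω := fun k => {ω | ∃ i ≤ k, Δ ≤ reachSup V G B x i (fun j => v j ω)}
  have hTmono : Monotone T := fun k l hkl ω ⟨i, hi, h⟩ => ⟨i, hi.trans hkl, h⟩
  have hsub : {ω | ReachableWithin G Xᵤ N x
      (fun i => (v i ω : EuclideanSpace ℝ (Fin m)))} ⊆ ⋃ k, T k := by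
    intro ω hω
    obtain ⟨k, z, hz, hzu⟩ :=
      ReachableWithin.exists_mem_reachSet (Set.mem_ofPred_eq ▸ hω)
    refine Set.mem_iUnion.2 ⟨k, k, le_rfl, (hB.ge_on_unsafe z hzu).trans ?_⟩
    exact hG.le_reachSup hB.usc hx (reachSet_subtype (V := V) ▸ hz)
  have hT : ∀ k, P (T k) ≤ ENNReal.ofReal (δ / Δ) := fun k => by
    -- Points with `B y < Δ` are outside `Xᵤ`, so `hsup` applies to them.
    have h := hG.mul_measure_add_lintegral_le hGconv hv_meas hv_indep hv_law hμ hB.usc hB.nonneg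
      hBconc (Δ := Δ) (fun y hy hyΔ => hsup y ⟨hy, fun hyu => hyΔ.not_ge (hB.ge_on_unsafe y hyu)⟩)
      hx (hxδ.trans_lt hB.delta_lt) k
    rw [ENNReal.ofReal_div_of_pos hΔ, ENNReal.le_div_iff_mul_le (by simp [hΔ]) (by simp), mul_comm]
    exact (le_self_add.trans h).trans (ENNReal.ofReal_le_ofReal hxδ)
  -- Monotonicity holds for outer measure, so the reachability event need not be measurable; the
  -- increasing union covers `N = ∞`.
  calc P _ ≤ P (⋃ k, T k) := measure_mono hsub
    _ = ⨆ k, P (T k) := hTmono.measure_iUnion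
    _ ≤ ENNReal.ofReal (δ / Δ) := iSup_le hT
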